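/- The weight $w(X)$ of a topological space $X$ is the least cardinality of a basis of its topology. A subset $T$ of a compact group $G$ is called suitable if $1\notin T$, $T$ is closed and discrete in $G\setminus\{1\}$, and $G=\overline{\langle T\rangle}$. Let $G$ be a profinite group (that is, a compact totally disconnected topological group) of uncountable weight and let $\aleph<w(G)$ be an infinite cardinal. Then $G$ has a closed subgroup $H$ with $w(H)=\aleph$. Moreover, $H$ can be chosen of the form $H=\overline{\langle S\rangle}$, where $S$ is a subset of cardinality $\aleph$ of a suitable set $T$ of $G$. -/

import Mathlib

open scoped Cardinal

universe u

/-- The weight of a topological space: the least cardinality of a basis of its topology. -/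
noncomputable def topWeight (X : Type u) [TopologicalSpace X] : Cardinal.{u} :=
  sInf {c | ∃ B : Set (Set X), TopologicalSpace.IsTopologicalBasis B ∧ #B = c}

/-- The weight is attained, so the infimum above is a minimum over a non-empty set. -/
theorem exists_basis_card_eq_topWeight (X : Type u) [TopologicalSpace X] :
    ∃ B : Set (Set X), TopologicalSpace.IsTopologicalBasis B ∧ #B = topWeight X :=
  csInf_mem (s := {c | ∃ B : Set (Set X), TopologicalSpace.IsTopologicalBasis B ∧ #B = c})
    ⟨_, _, TopologicalSpace.isTopologicalBasis_opens, rfl⟩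

/-- A subset `S` of a topological group `G` is suitable if it does not contain `1`, is closed and
discrete in the subspace `G \ {1}`, and generates a dense subgroup of `G`. -/
structure IsSuitable {G : Type u} [Group G] [TopologicalSpace G] [IsTopologicalGroup G]
    (S : Set G) : Prop where
  one_notMem : (1 : G) ∉ S
  isClosed_compl_one : IsClosed (Subtype.val ⁻¹' S : Set {x : G // x ≠ 1})
  isDiscrete_compl_one : IsDiscrete (Subtype.val ⁻¹' S : Set {x : G // x ≠ 1})
  topologicalClosure_eq_top : (Subgroup.closure S).topologicalClosure = ⊤

/-! The group `G` has a topological generating set `T` converging to `1` with `1 ∉ T`, and such a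
set is suitable. An infinite set converging to `1` and avoiding `1` generates a closed subgroup of
weight equal to its cardinality (`ConvergesToOne.topWeight_closure_eq`): open normal subgroups are
coded by finite data on the set, and its points are separated by basic open sets. As `w(G) ≤ max ℵ₀
#T` and `w(G)` is uncountable, `κ ≤ #T`, so any `S ⊆ T` of size `κ` works. The set `T` comes from
Zorn's lemma: unions of cosets of `N` converging to `N` are refined until `N` is trivial. -/

/-- A subset of a topological group generates it topologically if it lies in no proper open
subgroup. -/
def TopGenerates {G : Type u} [Group G] [TopologicalSpace G] (T : Set G) : Prop :=
  ∀ V : Subgroup G, IsOpen (V : Set G) → T ⊆ V → V = ⊤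

/-- A subset of a topological group converges to `1` if every open subgroup contains all but
finitely many of its elements. -/
def ConvergesToOne {G : Type u} [Group G] [TopologicalSpace G] (T : Set G) : Prop :=
  ∀ U : Subgroup G, IsOpen (U : Set G) → (T \ U).Finite

/-! ### Generating sets converging to the identity, by Zorn's lemma -/

theorem finite_image_mk_of_refine {G : Type u} [Group G] {N M : Subgroup G} {S : Set G}
    (hS : ((QuotientGroup.mk : G → G ⧸ N) '' S).Finite)
    (h : ∀ a ∈ S, ∀ b ∈ S, a⁻¹ * b ∈ N → a⁻¹ * b ∈ M) :
    ((QuotientGroup.mk : G → G ⧸ M) '' S).Finite := by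
  choose! g hgS hg using fun (q : G ⧸ N) (hq : q ∈ (QuotientGroup.mk : G → G ⧸ N) '' S) => hq
  refine (hS.image fun q => (g q : G ⧸ M)).subset ?_
  rintro _ ⟨a, ha, rfl⟩
  have hq : (a : G ⧸ N) ∈ (QuotientGroup.mk : G → G ⧸ N) '' S := ⟨a, ha, rfl⟩
  exact ⟨_, hq, QuotientGroup.eq.2 (h _ (hgS _ hq) _ ha (QuotientGroup.eq.1 (hg _ hq)))⟩

/-- A closed subgroup `N` with a closed topologically generating union `A` of left cosets of `N`
which converge to `N`. -/
structure CosetApprox (G : Type u) [Group G] [TopologicalSpace G] where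
  N : Subgroup G
  A : Set G
  isClosed_N : IsClosed (N : Set G)
  isClosed_A : IsClosed A
  subset_A : (N : Set G) ⊆ A
  mul_mem : ∀ a ∈ A, ∀ n ∈ N, a * n ∈ A
  finite_diff : ∀ W : Set G, IsOpen W → (N : Set G) ⊆ W →
    ((QuotientGroup.mk : G → G ⧸ N) '' (A \ W)).Finite
  generates : TopGenerates A

namespace CosetApprox

variable {G : Type u} [Group G] [TopologicalSpace G]

/-- `q` refines `p`: each nontrivial coset of `p` contains at most one coset of `q`. -/
def Refines (p q : CosetApprox G) : Prop :=
  q.N ≤ p.N ∧ q.A ⊆ p.A ∧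
    ∀ a ∈ q.A, ∀ b ∈ q.A, a ∉ p.N → a⁻¹ * b ∈ p.N → a⁻¹ * b ∈ q.N

theorem Refines.refl (p : CosetApprox G) : Refines p p :=
  ⟨le_rfl, subset_rfl, fun _ _ _ _ _ h => h⟩

theorem Refines.trans {p q r : CosetApprox G} (h : Refines p q) (h' : Refines q r) :
    Refines p r :=
  ⟨h'.1.trans h.1, h'.2.1.trans h.2.1, fun a ha b hb hap hab =>
    h'.2.2 a ha b hb (fun haq => hap (h.1 haq))
      (h.2.2 a (h'.2.1 ha) b (h'.2.1 hb) hap hab)⟩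

/-- The whole group is an approximation. -/
def top (G : Type u) [Group G] [TopologicalSpace G] : CosetApprox G where
  N := ⊤
  A := Set.univ
  isClosed_N := isClosed_univ
  isClosed_A := isClosed_univ
  subset_A := Set.subset_univ _
  mul_mem _ _ _ _ := trivial
  finite_diff W _ h := by
    have : (Set.univ : Set G) \ W = ∅ := Set.sdiff_eq_empty.2 h
    simp [this]
  generates V _ h := by
    rw [← SetLike.coe_set_eq]
    exact Set.eq_univ_of_univ_subset h

variable [CompactSpace G]

/-- Intersect everything. By compactness an open set containing the limit already contains some
member of the chain. Refinement never splits a nontrivial coset in two, so finiteness and generation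
pass to the limit. -/
theorem exists_upperBound {c : Set (CosetApprox G)} (hc : IsChain Refines c)
    (hne : c.Nonempty) : ∃ q, ∀ p ∈ c, Refines p q := by
  have : Nonempty c := hne.to_subtype
  have hdir : ∀ p q : c, ∃ r : c, Refines p.1 r.1 ∧ Refines q.1 r.1 := by
    intro p q
    rcases eq_or_ne p.1 q.1 with h | h
    · exact ⟨p, Refines.refl _, h ▸ Refines.refl _⟩
    · rcases hc p.2 q.2 h with h | h
      · exact ⟨q, h, Refines.refl _⟩
      · exact ⟨p, Refines.refl _, h⟩
  set K : Subgroup G := ⨅ p : c, p.1.N with hK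
  set B : Set G := ⋂ p : c, p.1.A with hB
  have hKcoe : (K : Set G) = ⋂ p : c, (p.1.N : Set G) := by simp [hK]
  have hKmem : ∀ x, x ∈ K ↔ ∀ p : c, x ∈ p.1.N := fun x => by simp [hK, Subgroup.mem_iInf]
  have hBmem : ∀ x, x ∈ B ↔ ∀ p : c, x ∈ p.1.A := fun x => by simp [hB]
  have hsub : ∀ W : Set G, IsOpen W → (K : Set G) ⊆ W → ∃ p : c, (p.1.N : Set G) ⊆ W := by
    intro W hW hKW
    refine exists_subset_nhds_of_isCompact' (V := fun p : c => (p.1.N : Set G)) ?_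
      (fun p => p.1.isClosed_N.isCompact) (fun p => p.1.isClosed_N)
      fun x hx => hW.mem_nhds (hKW (hKcoe ▸ hx))
    intro p q
    obtain ⟨r, hr, hr'⟩ := hdir p q
    exact ⟨r, hr.1, hr'.1⟩
  have hsubA : ∀ W : Set G, IsOpen W → B ⊆ W → ∃ p : c, p.1.A ⊆ W := by
    intro W hW hBW
    refine exists_subset_nhds_of_isCompact' (V := fun p : c => p.1.A) ?_
      (fun p => p.1.isClosed_A.isCompact) (fun p => p.1.isClosed_A)
      fun x hx => hW.mem_nhds (hBW hx)
    intro p q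
    obtain ⟨r, hr, hr'⟩ := hdir p q
    exact ⟨r, hr.2.1, hr'.2.1⟩
  have hsingle : ∀ p : c, ∀ a ∈ B, ∀ b ∈ B, a ∉ p.1.N → a⁻¹ * b ∈ p.1.N → a⁻¹ * b ∈ K := by
    intro p a ha b hb hap hab
    rw [hKmem]
    intro q
    obtain ⟨r, hr, hr'⟩ := hdir p q
    exact hr'.1 (hr.2.2 a ((hBmem a).1 ha r) b ((hBmem b).1 hb r) hap hab)
  refine ⟨⟨K, B, ?_, isClosed_iInter fun p => p.1.isClosed_A, ?_, ?_, ?_, ?_⟩, ?_⟩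
  · rw [hKcoe]
    exact isClosed_iInter fun p => p.1.isClosed_N
  · exact fun x hx => (hBmem x).2 fun p => p.1.subset_A ((hKmem x).1 hx p)
  · exact fun a ha n hn => (hBmem _).2 fun p =>
      p.1.mul_mem a ((hBmem a).1 ha p) n ((hKmem n).1 hn p)
  · intro W hW hKW
    obtain ⟨p, hp⟩ := hsub W hW hKW
    refine finite_image_mk_of_refine (N := p.1.N)
      ((p.1.finite_diff W hW hp).subset (Set.image_mono
        (Set.sdiff_subset_sdiff_left (Set.iInter_subset _ p)))) ?_
    exact fun a ha b hb hab => hsingle p a ha.1 b hb.1 (fun h => ha.2 (hp h)) hab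
  · intro V hV hBV
    obtain ⟨p, hp⟩ := hsubA V hV hBV
    exact p.1.generates V hV hp
  · exact fun p hp => ⟨fun x hx => (hKmem x).1 hx ⟨p, hp⟩, Set.iInter_subset _ (⟨p, hp⟩ : c),
      hsingle ⟨p, hp⟩⟩

variable [IsTopologicalGroup G]

-- A coset of `N` that meets `U` does so in a single coset of `N ⊓ U`, which is kept. Only finitely
-- many cosets in `A` miss `U`; in each, one coset of `N ⊓ U` is chosen. Keeping all of `N`
-- preserves generation, and costs only finitely many cosets since `U` has finite index.
open scoped Pointwise in
theorem exists_refines_inf (p : CosetApprox G) (U : Subgroup G) (hU : IsOpen (U : Set G)) :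
    ∃ q, Refines p q ∧ q.N = p.N ⊓ U := by
  have hUc : IsClosed (U : Set G) := Subgroup.isClosed_of_isOpen U hU
  have hUfin : Finite (G ⧸ U) := Subgroup.quotient_finite_of_isOpen U hU
  set UN : Set G := (U : Set G) * (p.N : Set G) with hUN
  have hUNmul : ∀ a, ∀ n ∈ p.N, a * n ∈ UN ↔ a ∈ UN := by
    intro a n hn
    constructor
    · rintro ⟨u, hu, m, hm, h⟩
      exact ⟨u, hu, m * n⁻¹, p.N.mul_mem hm (p.N.inv_mem hn), by
        simp only at h ⊢; rw [← mul_assoc, h]; group⟩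
    · rintro ⟨u, hu, m, hm, rfl⟩
      exact ⟨u, hu, m * n, p.N.mul_mem hm hn, by simp [mul_assoc]⟩
  have hUsub : (U : Set G) ⊆ UN := fun u hu => ⟨u, hu, 1, p.N.one_mem, by simp⟩
  have hNsub : (p.N : Set G) ⊆ UN := fun n hn => ⟨1, U.one_mem, n, hn, by simp⟩
  have hQ := p.finite_diff UN hU.mul_right hNsub
  set Q := (QuotientGroup.mk : G → G ⧸ p.N) '' (p.A \ UN) with hQdef
  set F : Set G := Quotient.out '' Q with hF
  have hFfin : F.Finite := hQ.image _
  have hFA : ∀ f ∈ F, f ∈ p.A ∧ f ∉ UN := by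
    rintro _ ⟨_, ⟨a, ha, rfl⟩, rfl⟩
    have h : a⁻¹ * Quotient.out (a : G ⧸ p.N) ∈ p.N :=
      QuotientGroup.eq.1 (QuotientGroup.out_eq' _).symm
    have h' := p.mul_mem a ha.1 _ h
    have h2 := hUNmul a _ h
    rw [mul_inv_cancel_left] at h' h2
    exact ⟨h', fun hh => ha.2 (h2.1 hh)⟩
  have hFinj : ∀ f ∈ F, ∀ f' ∈ F, f⁻¹ * f' ∈ p.N → f = f' := by
    rintro _ ⟨q, hq, rfl⟩ _ ⟨q', hq', rfl⟩ h
    have := QuotientGroup.eq.2 h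
    rw [QuotientGroup.out_eq', QuotientGroup.out_eq'] at this
    rw [this]
  have hFsurj : ∀ a ∈ p.A \ UN, ∃ f ∈ F, f⁻¹ * a ∈ p.N := fun a ha =>
    ⟨_, ⟨_, ⟨a, ha, rfl⟩, rfl⟩, QuotientGroup.eq.1 (QuotientGroup.out_eq' _)⟩
  set M : Subgroup G := p.N ⊓ U with hM
  have hMc : IsClosed (M : Set G) := p.isClosed_N.inter hUc
  have hFM : ∀ x ∈ F * (M : Set G), x ∈ p.A ∧ x ∉ UN := by
    rintro _ ⟨f, hf, m, hm, rfl⟩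
    exact ⟨p.mul_mem f (hFA f hf).1 m hm.1, fun h => (hFA f hf).2 ((hUNmul f m hm.1).1 h)⟩
  set B : Set G := (p.N ∪ (p.A ∩ U)) ∪ F * (M : Set G) with hB
  have hBA : B ⊆ p.A := by
    rintro x ((hx | hx) | hx)
    · exact p.subset_A hx
    · exact hx.1
    · exact (hFM x hx).1
  refine ⟨⟨M, B, hMc, ?_, ?_, ?_, ?_, ?_⟩, ⟨inf_le_left, hBA, ?_⟩, rfl⟩
  · exact (p.isClosed_N.union (p.isClosed_A.inter hUc)).union
      (hMc.mul_left_of_isCompact hFfin.isCompact)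
  · exact fun x hx => Or.inl (Or.inl hx.1)
  · rintro a ((ha | ha) | ⟨f, hf, m, hm, rfl⟩) n hn
    · exact Or.inl (Or.inl (p.N.mul_mem ha hn.1))
    · exact Or.inl (Or.inr ⟨p.mul_mem a ha.1 n hn.1, U.mul_mem ha.2 hn.2⟩)
    · exact Or.inr ⟨f, hf, m * n, M.mul_mem hm hn, by simp [mul_assoc]⟩
  · intro W hW hMW
    have h1 : ((QuotientGroup.mk : G → G ⧸ M) '' (p.N : Set G)).Finite :=
      finite_image_mk_of_refine (N := U) (Set.toFinite _) fun a ha b hb h =>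
        ⟨p.N.mul_mem (p.N.inv_mem ha) hb, h⟩
    have h2 : ((QuotientGroup.mk : G → G ⧸ M) '' ((p.A ∩ U) \ W)).Finite := by
      -- Since `N ⊓ U ⊆ W`, the open set `W ∪ Uᶜ` contains `N`, so convergence of `A` applies to it.
      refine finite_image_mk_of_refine (N := p.N)
        ((p.finite_diff (W ∪ (U : Set G)ᶜ) (hW.union hUc.isOpen_compl) ?_).subset
          (Set.image_mono ?_)) ?_
      · intro x hx
        by_cases hxU : x ∈ U
        · exact Or.inl (hMW ⟨hx, hxU⟩)
        · exact Or.inr hxU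
      · rintro x ⟨⟨hx, hxU⟩, hxW⟩
        exact ⟨hx, fun h => h.elim hxW fun h => h hxU⟩
      · exact fun a ha b hb h => ⟨h, U.mul_mem (U.inv_mem ha.1.2) hb.1.2⟩
    have h3 : ((QuotientGroup.mk : G → G ⧸ M) '' (F * (M : Set G))).Finite := by
      refine (hFfin.image (QuotientGroup.mk : G → G ⧸ M)).subset ?_
      rintro _ ⟨_, ⟨f, hf, m, hm, rfl⟩, rfl⟩
      exact ⟨f, hf, QuotientGroup.eq.2 (by simpa using hm)⟩
    refine ((h1.union h2).union h3).subset ?_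
    rintro _ ⟨x, ⟨(hx | hx) | hx, hxW⟩, rfl⟩
    · exact Or.inl (Or.inl ⟨x, hx, rfl⟩)
    · exact Or.inl (Or.inr ⟨x, ⟨hx, hxW⟩, rfl⟩)
    · exact Or.inr ⟨x, hx, rfl⟩
  · intro V hV hBV
    refine p.generates V hV fun a ha => ?_
    have hNV : ∀ n ∈ p.N, n ∈ V := fun n hn => hBV (Or.inl (Or.inl hn))
    by_cases haU : a ∈ UN
    · obtain ⟨u, hu, n, hn, rfl⟩ := haU
      have : u ∈ p.A := by simpa using p.mul_mem _ ha _ (p.N.inv_mem hn)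
      exact V.mul_mem (hBV (Or.inl (Or.inr ⟨this, hu⟩))) (hNV n hn)
    · obtain ⟨f, hf, h⟩ := hFsurj a ⟨ha, haU⟩
      have := V.mul_mem (hBV (Or.inr ⟨f, hf, 1, M.one_mem, by simp⟩) : f ∈ V) (hNV _ h)
      simpa using this
  · have hBUN : ∀ x ∈ B, x ∉ p.N → x ∈ UN → x ∈ U := by
      rintro x ((hx | hx) | hx) hxN hxU
      · exact (hxN hx).elim
      · exact hx.2
      · exact ((hFM x hx).2 hxU).elim
    have hBnUN : ∀ x ∈ B, x ∉ UN → x ∈ F * (M : Set G) := by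
      rintro x ((hx | hx) | hx) hxU
      · exact (hxU (hNsub hx)).elim
      · exact (hxU (hUsub hx.2)).elim
      · exact hx
    intro a ha b hb haN hab
    have hbN : b ∉ p.N := fun h => haN (by
      have := p.N.mul_mem h (p.N.inv_mem hab)
      simpa using this)
    have hiff := hUNmul a _ hab
    rw [mul_inv_cancel_left] at hiff
    by_cases haU : a ∈ UN
    · exact ⟨hab, U.mul_mem (U.inv_mem (hBUN a ha haN haU)) (hBUN b hb hbN (hiff.2 haU))⟩
    · obtain ⟨f, hf, m, hm, rfl⟩ := hBnUN a ha haU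
      obtain ⟨f', hf', m', hm', rfl⟩ := hBnUN b hb (fun h => haU (hiff.1 h))
      have : f⁻¹ * f' ∈ p.N := by
        have := p.N.mul_mem (p.N.mul_mem hm.1 hab) (p.N.inv_mem hm'.1)
        simpa [mul_assoc] using this
      obtain rfl := hFinj f hf f' hf' this
      simpa [mul_assoc] using M.mul_mem (M.inv_mem hm) hm'

theorem exists_N_eq_bot [TotallyDisconnectedSpace G] : ∃ p : CosetApprox G, p.N = ⊥ := by
  have : Nonempty (CosetApprox G) := ⟨top G⟩
  obtain ⟨p, hp⟩ := exists_maximal_of_nonempty_chains_bounded (r := Refines (G := G))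
    (fun c hc hne => exists_upperBound hc hne) Refines.trans
  refine ⟨p, (Subgroup.eq_bot_iff_forall _).2 fun x hx => ?_⟩
  by_contra hx1
  obtain ⟨U, hU⟩ := ProfiniteGrp.exist_openNormalSubgroup_sub_open_nhds_of_one
    (isOpen_compl_singleton (x := x)) (by simpa using Ne.symm hx1)
  obtain ⟨q, hpq, hq⟩ := p.exists_refines_inf U.toSubgroup U.isOpen'
  have hxq := (hp q hpq).1 hx
  rw [hq] at hxq
  exact hU hxq.2 rfl

end CosetApprox

/-- Every profinite group has a topological generating set converging to `1`. -/
theorem exists_convergesToOne_topGenerates (G : Type u) [Group G] [TopologicalSpace G]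
    [IsTopologicalGroup G] [CompactSpace G] [TotallyDisconnectedSpace G] :
    ∃ T : Set G, (1 : G) ∉ T ∧ ConvergesToOne T ∧ TopGenerates T := by
  obtain ⟨⟨N, A, -, -, -, -, hfin, hgen⟩, rfl⟩ := CosetApprox.exists_N_eq_bot (G := G)
  refine ⟨A \ {1}, fun h => h.2 rfl, fun U hU => ?_, fun V hV hAV => hgen V hV fun a ha => ?_⟩
  -- Cosets of the trivial subgroup are points.
  · have := (hfin U hU (by simp [U.one_mem])).of_finite_image
      (fun a _ b _ h => by simpa [inv_mul_eq_one] using QuotientGroup.eq.1 h)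
    exact this.subset fun x hx => ⟨hx.1.1, hx.2⟩
  · by_cases h : a = 1
    · exact h ▸ V.one_mem
    · exact hAV ⟨ha, h⟩

/-! ### Weight and suitability for sets converging to the identity -/

section Weight

variable {G : Type u} [Group G] [TopologicalSpace G]

theorem topGenerates_of_topologicalClosure_eq_top [IsTopologicalGroup G] {T : Set G}
    (h : (Subgroup.closure T).topologicalClosure = ⊤) : TopGenerates T := fun V hV hTV =>
  top_le_iff.1 (h ▸ Subgroup.topologicalClosure_minimal _ ((Subgroup.closure_le V).2 hTV)
    (Subgroup.isClosed_of_isOpen V hV))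

/-- Two homomorphisms with open kernels which agree on a topological generating set have the same
kernel. -/
theorem TopGenerates.ker_eq [IsTopologicalGroup G] {T : Set G} (hgen : TopGenerates T) {m m' : ℕ}
    {φ : G →* Equiv.Perm (Fin m)} {ψ : G →* Equiv.Perm (Fin m')} (hm : m = m')
    (h : ∀ t ∈ T, (⟨m, φ t⟩ : Σ m : ℕ, Equiv.Perm (Fin m)) = ⟨m', ψ t⟩)
    (hφ : IsOpen (φ.ker : Set G)) (hψ : IsOpen (ψ.ker : Set G)) : φ.ker = ψ.ker := by
  subst hm
  have hopen : IsOpen ((φ.eqLocus ψ : Subgroup G) : Set G) :=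
    Subgroup.isOpen_mono (H₁ := φ.ker ⊓ ψ.ker)
      (fun x hx => ((MonoidHom.mem_ker).1 hx.1).trans ((MonoidHom.mem_ker).1 hx.2).symm)
      (hφ.inter hψ)
  have htop := hgen _ hopen fun t ht => eq_of_heq (Sigma.mk.inj (h t ht)).2
  rw [MonoidHom.eq_of_eqOn_top fun x _ => (htop ▸ Subgroup.mem_top x : x ∈ φ.eqLocus ψ)]

variable [IsTopologicalGroup G] [CompactSpace G] {T : Set G}

/-- A group with a topological generating set `T` converging to `1` has at most `max ℵ₀ #T` open
normal subgroups: such a subgroup is the kernel of a permutation representation of finite degree,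
which is determined by the finitely many values on `T` different from `1`. -/
theorem ConvergesToOne.mk_openNormalSubgroup_le (hT : ConvergesToOne T) (hgen : TopGenerates T) :
    #(OpenNormalSubgroup G) ≤ max ℵ₀ #T := by
  have hrep : ∀ N : OpenNormalSubgroup G, ∃ (n : ℕ) (φ : G →* Equiv.Perm (Fin n)),
      φ.ker = N.toSubgroup := by
    intro N
    have : Finite (G ⧸ N.toSubgroup) := Subgroup.quotient_finite_of_isOpen _ N.isOpen'
    obtain ⟨n, ⟨e⟩⟩ := Finite.exists_equiv_fin (G ⧸ N.toSubgroup)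
    refine ⟨n, (e.permCongrHom : _ →* _).comp
      ((MulAction.toPermHom (G ⧸ N.toSubgroup) (G ⧸ N.toSubgroup)).comp
        (QuotientGroup.mk' N.toSubgroup)), ?_⟩
    rw [MonoidHom.ker_comp_of_injective, MonoidHom.ker_comp_of_injective, QuotientGroup.ker_mk']
    · exact MulAction.toPerm_injective
    · exact e.permCongrHom.injective
  choose n φ hφ using hrep
  -- The degree is stored separately: it fixes the identity permutation taken at the unlisted points
  -- of `T`, and the list may be empty.
  let code : OpenNormalSubgroup G → ℕ × List (T × Σ m : ℕ, Equiv.Perm (Fin m)) := fun N =>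
    (n N, ((hT N.toSubgroup N.isOpen').preimage
      (Subtype.val_injective.injOn : Set.InjOn (Subtype.val : T → G) _)).toFinset.toList.map
        fun t => (t, ⟨n N, φ N t⟩))
  have hcode : Function.Injective code := by
    intro N N' h
    have hn : n N = n N' := congrArg Prod.fst h
    have hmem : ∀ (M : OpenNormalSubgroup G) (t : T) (x : Σ m : ℕ, Equiv.Perm (Fin m)),
        (t, x) ∈ (code M).2 ↔ (t : G) ∉ M ∧ (⟨n M, φ M t⟩ : Σ m : ℕ, Equiv.Perm (Fin m)) = x := by
      intro M t x
      simp only [code, List.mem_map, Finset.mem_toList, Set.Finite.mem_toFinset, Prod.mk.injEq]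
      constructor
      · rintro ⟨t', ht', rfl, rfl⟩
        exact ⟨ht'.2, rfl⟩
      · rintro ⟨ht, rfl⟩
        exact ⟨t, ⟨t.2, ht⟩, rfl, rfl⟩
    have hone : ∀ (M : OpenNormalSubgroup G), ∀ t ∈ M, φ M t = 1 := fun M t ht =>
      (MonoidHom.mem_ker (f := φ M)).1 ((hφ M).symm ▸ ht)
    have hval : ∀ t ∈ T, (⟨n N, φ N t⟩ : Σ m : ℕ, Equiv.Perm (Fin m)) = ⟨n N', φ N' t⟩ := by
      intro t ht
      by_cases htN : t ∈ N
      · by_cases htN' : t ∈ N'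
        · rw [hone N t htN, hone N' t htN', hn]
        · exact ((hmem N ⟨t, ht⟩ _).1 (h ▸ (hmem N' ⟨t, ht⟩ _).2 ⟨htN', rfl⟩)).2
      · exact (((hmem N' ⟨t, ht⟩ _).1 (h ▸ (hmem N ⟨t, ht⟩ _).2 ⟨htN, rfl⟩)).2).symm
    have hker : (φ N).ker = (φ N').ker :=
      hgen.ker_eq hn hval (hφ N ▸ N.isOpen') (hφ N' ▸ N'.isOpen')
    exact OpenNormalSubgroup.toSubgroup_injective ((hφ N).symm.trans (hker.trans (hφ N')))
  refine (Cardinal.mk_le_of_injective hcode).trans ?_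
  have h1 : #(Σ m : ℕ, Equiv.Perm (Fin m)) ≤ ℵ₀ := Cardinal.mk_le_aleph0
  have h2 : #(T × Σ m : ℕ, Equiv.Perm (Fin m)) ≤ max ℵ₀ #T := by
    rw [Cardinal.mk_prod]
    simp only [Cardinal.lift_uzero]
    exact (Cardinal.mul_le_max _ _).trans
      (max_le (max_le (le_max_right _ _) ((Cardinal.lift_le_aleph0.2 h1).trans (le_max_left _ _)))
        (le_max_left _ _))
  rw [Cardinal.mk_prod]
  refine (Cardinal.mul_le_max _ _).trans (max_le (max_le (by simp) ?_) (le_max_left _ _))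
  simpa only [Cardinal.lift_uzero] using
    (Cardinal.mk_list_le_max _).trans (max_le (le_max_left _ _) h2)

variable [TotallyDisconnectedSpace G]

theorem TopGenerates.topologicalClosure_eq_top (h : TopGenerates T) :
    (Subgroup.closure T).topologicalClosure = ⊤ := by
  let C : ClosedSubgroup G :=
    ⟨(Subgroup.closure T).topologicalClosure, Subgroup.isClosed_topologicalClosure _⟩
  change C.toSubgroup = ⊤
  rw [ProfiniteGrp.closedSubgroup_eq_sInf_open C, sInf_eq_top]
  rintro V ⟨hV, hCV⟩
  exact h V hV (Subgroup.subset_closure.trans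
    ((Subgroup.le_topologicalClosure (Subgroup.closure T)).trans hCV))

/-- Outside an open subgroup avoiding `x` only finitely many points of `T` remain, and those other
than `x` can be removed. -/
theorem ConvergesToOne.exists_isOpen_inter_subset (hT : ConvergesToOne T) {x : G} (hx : x ≠ 1) :
    ∃ W : Set G, IsOpen W ∧ x ∈ W ∧ W ∩ T ⊆ {x} := by
  obtain ⟨U, hU⟩ := ProfiniteGrp.exist_openNormalSubgroup_sub_open_nhds_of_one
    (isOpen_compl_singleton (x := x)) (by simpa using hx.symm)
  have hfin : ((T \ U) \ {x}).Finite := (hT U.toSubgroup U.isOpen').sdiff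
  refine ⟨(U : Set G)ᶜ ∩ ((T \ U) \ {x})ᶜ, ?_, ⟨fun h => hU h rfl, fun h => h.2 rfl⟩, ?_⟩
  · exact (Subgroup.isClosed_of_isOpen U.toSubgroup U.isOpen').isOpen_compl.inter
      hfin.isClosed.isOpen_compl
  · rintro y ⟨⟨hyU, hy⟩, hyT⟩
    by_contra hyx
    exact hy ⟨⟨hyT, hyU⟩, hyx⟩

theorem ConvergesToOne.isSuitable (hT : ConvergesToOne T) (h1 : (1 : G) ∉ T)
    (hgen : TopGenerates T) : IsSuitable T where
  one_notMem := h1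
  isClosed_compl_one := by
    rw [← isOpen_compl_iff, isOpen_iff_forall_mem_open]
    intro x hx
    obtain ⟨W, hW, hxW, hWT⟩ := hT.exists_isOpen_inter_subset x.2
    refine ⟨Subtype.val ⁻¹' W, fun y hy hyT => hx ?_, hW.preimage continuous_subtype_val, hxW⟩
    have : y = x := Subtype.ext (hWT ⟨hy, hyT⟩)
    exact this ▸ hyT
  isDiscrete_compl_one := by
    rw [isDiscrete_iff_forall_mem_exists_isOpen]
    intro x hx
    obtain ⟨W, hW, hxW, hWT⟩ := hT.exists_isOpen_inter_subset x.2
    refine ⟨Subtype.val ⁻¹' W, hW.preimage continuous_subtype_val, ?_⟩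
    refine Set.Subset.antisymm (fun y hy => Subtype.ext (hWT hy)) ?_
    rintro _ rfl
    exact ⟨hxW, hx⟩
  topologicalClosure_eq_top := hgen.topologicalClosure_eq_top

theorem ConvergesToOne.mk_le_topWeight (hT : ConvergesToOne T) (h1 : (1 : G) ∉ T) :
    #T ≤ topWeight G := by
  obtain ⟨B, hB, hcard⟩ := exists_basis_card_eq_topWeight G
  rw [← hcard]
  have key : ∀ t : T, ∃ V : B, (t : G) ∈ (V : Set G) ∧ (V : Set G) ∩ T ⊆ {(t : G)} := by
    intro t
    obtain ⟨W, hW, htW, hWT⟩ :=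
      hT.exists_isOpen_inter_subset (x := t) fun h => h1 (h ▸ t.2)
    obtain ⟨V, hV, htV, hVW⟩ := hB.exists_subset_of_mem_open htW hW
    exact ⟨⟨V, hV⟩, htV, (Set.inter_subset_inter_left _ hVW).trans hWT⟩
  choose f hf hfT using key
  refine Cardinal.mk_le_of_injective (f := f) fun s t hst => Subtype.ext ?_
  exact hfT t ⟨hst ▸ hf s, s.2⟩

/-- The cosets of open normal subgroups form a basis, and each such subgroup has finitely many. -/
theorem ConvergesToOne.topWeight_le (hT : ConvergesToOne T) (hgen : TopGenerates T) :
    topWeight G ≤ max ℵ₀ #T := by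
  let c : (Σ N : OpenNormalSubgroup G, G ⧸ N.toSubgroup) → Set G :=
    fun q => (QuotientGroup.mk : G → G ⧸ q.1.toSubgroup) ⁻¹' {q.2}
  have hc : TopologicalSpace.IsTopologicalBasis (Set.range c) := by
    refine TopologicalSpace.isTopologicalBasis_of_isOpen_of_nhds ?_ ?_
    · rintro _ ⟨⟨N, q⟩, rfl⟩
      have : DiscreteTopology (G ⧸ N.toSubgroup) := QuotientGroup.discreteTopology N.isOpen'
      exact (isOpen_discrete {q}).preimage QuotientGroup.continuous_mk
    · intro a W ha hW
      obtain ⟨N, hN⟩ := ProfiniteGrp.exist_openNormalSubgroup_sub_open_nhds_of_one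
        (hW.preimage (continuous_const_mul a)) (by simpa using ha)
      refine ⟨_, ⟨⟨N, (a : G ⧸ N.toSubgroup)⟩, rfl⟩, rfl, fun x hx => ?_⟩
      have : a * (a⁻¹ * x) ∈ W := hN (QuotientGroup.eq.1 (Eq.symm hx))
      simpa using this
  refine (csInf_le' ⟨_, hc, rfl⟩ : topWeight G ≤ #(Set.range c)).trans
    (Cardinal.mk_range_le.trans ?_)
  rw [Cardinal.mk_sigma]
  have hfin : ∀ N : OpenNormalSubgroup G, #(G ⧸ N.toSubgroup) ≤ ℵ₀ := fun N => by
    have : Finite (G ⧸ N.toSubgroup) := Subgroup.quotient_finite_of_isOpen _ N.isOpen'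
    exact Cardinal.mk_le_aleph0
  refine (Cardinal.sum_le_sum _ (fun _ => ℵ₀) hfin).trans ?_
  rw [Cardinal.sum_const']
  exact (Cardinal.mul_le_max _ _).trans
    (max_le (max_le (hT.mk_openNormalSubgroup_le hgen) (le_max_left _ _)) (le_max_left _ _))

/-- The closed subgroup generated by an infinite set converging to `1` has weight the cardinality
of the set. -/
theorem ConvergesToOne.topWeight_closure_eq (hT : ConvergesToOne T) (h1 : (1 : G) ∉ T)
    (hinf : ℵ₀ ≤ #T) : topWeight (Subgroup.closure T).topologicalClosure = #T := by
  set H := (Subgroup.closure T).topologicalClosure with hH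
  have hHc : IsClosed (H : Set G) := Subgroup.isClosed_topologicalClosure _
  have : CompactSpace H := isCompact_iff_compactSpace.1 hHc.isCompact
  have hTH : T ⊆ H := Subgroup.subset_closure.trans (Subgroup.le_topologicalClosure _)
  set S : Set H := Subtype.val ⁻¹' T with hS
  have hST : (Subtype.val : H → G) '' S = T :=
    Set.Subset.antisymm (Set.image_preimage_subset _ _) fun t ht => ⟨⟨t, hTH ht⟩, ht, rfl⟩
  have hcard : #S = #T := by
    rw [← Cardinal.mk_image_eq (s := S) Subtype.val_injective, hST]
  have hS1 : (1 : H) ∉ S := h1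
  have hSc : ConvergesToOne S := by
    intro U hU
    obtain ⟨W, hW, hWU⟩ := isOpen_induced_iff.1 hU
    obtain ⟨N, hN⟩ := ProfiniteGrp.exist_openNormalSubgroup_sub_open_nhds_of_one hW
      (show (1 : H) ∈ Subtype.val ⁻¹' W from hWU ▸ U.one_mem)
    refine ((hT N.toSubgroup N.isOpen').preimage Subtype.val_injective.injOn).subset ?_
    exact fun x hx => ⟨hx.1, fun h => hx.2 (hWU ▸ hN h)⟩
  have hSgen : TopGenerates S := by
    apply topGenerates_of_topologicalClosure_eq_top
    rw [eq_top_iff]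
    intro x _
    rw [← SetLike.mem_coe, Subgroup.topologicalClosure_coe,
      Topology.IsInducing.subtypeVal.closure_eq_preimage_closure_image]
    have hmap : (Subgroup.closure S).map H.subtype = Subgroup.closure T := by
      rw [MonoidHom.map_closure]
      exact congrArg Subgroup.closure hST
    have hx : (x : G) ∈ closure ((Subgroup.closure S).map H.subtype : Set G) := hmap ▸ x.2
    exact hx
  apply le_antisymm
  · simpa [hcard, hinf] using hSc.topWeight_le hSgen
  · exact hcard ▸ hSc.mk_le_topWeight hS1

end Weight

theorem lemma3p3 {G : Type u} [Group G] [TopologicalSpace G] [IsTopologicalGroup G]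
    [CompactSpace G] [TotallyDisconnectedSpace G]
    (hG : ℵ₀ < topWeight G) (κ : Cardinal.{u}) (hκ : ℵ₀ ≤ κ) (hκG : κ < topWeight G) :
    ∃ H : Subgroup G, IsClosed (H : Set G) ∧ topWeight H = κ ∧
      ∃ T : Set G, IsSuitable T ∧ ∃ S : Set G, S ⊆ T ∧ #S = κ ∧
        H = (Subgroup.closure S).topologicalClosure := by
  obtain ⟨T, h1, hT, hgen⟩ := exists_convergesToOne_topGenerates G
  have hκT : κ ≤ #T := by
    rcases le_max_iff.1 (hT.topWeight_le hgen) with h | h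
    -- Uncountable weight excludes this case.
    · exact (hG.not_ge h).elim
    · exact hκG.le.trans h
  obtain ⟨S, hST, rfl⟩ := Cardinal.le_mk_iff_exists_subset.1 hκT
  have hS : ConvergesToOne S := fun U hU => (hT U hU).subset fun x hx => ⟨hST hx.1, hx.2⟩
  exact ⟨_, Subgroup.isClosed_topologicalClosure _,
    hS.topWeight_closure_eq (fun h => h1 (hST h)) hκ, T, hT.isSuitable h1 hgen, S, hST, rfl, rfl⟩
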